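/- Let $\alpha\in\mathbb R$, let $U\subset\mathbb C\times\mathbb R$ be open with coordinates $(w,v)$, $w=x+iy$, and let $F=F(w,\overline w,v)$ be a smooth real function on $U$ with \[ (F\cos^2\alpha+F_{vv})F_{w\overline w}-(F_{\overline w}\cos\alpha-iF_{v\overline w})(F_w\cos\alpha+iF_{vw})=4e^{-2v\sin\alpha}. \] Put $4V:=F\cos^2\alpha+F_{vv}$, $2S:=F_w\cos\alpha+iF_{vw}$, $m:=e^{i\alpha}$, and consider the real one-forms \[ e^1=\tfrac12(e^{imv}dw+e^{-i\overline mv}d\overline w),\qquad e^2=\tfrac i2(e^{-i\overline mv}d\overline w-e^{imv}dw),\qquad e^3=V\,dv-\tfrac i2(S\,dw-\overline S\,d\overline w), \] \[ \nu=\frac{\cos\alpha\,(S\,dw+\overline S\,d\overline w)-2i\sin\alpha\,(\overline S\,d\overline w-S\,dw)}{V}-4\sin\alpha\,dv , \] the metric $h=(e^1)^2+(e^2)^2+(e^3)^2$ with orientation $e^1\wedge e^2\wedge e^3$, and the Einstein--Weyl structure $(h,\nu)$, whose Weyl connection $D$ is the torsion-free connection with $D_ih_{jk}=\nu_ih_{jk}$.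 Then $V$ vanishes nowhere on $U$, and: 1. The vector field $W$ which is $h$-dual to $e^3$ generates a shear-free geodesic congruence: $W$ is smooth and nowhere zero, $W^jD_jW^i$ is at each point a multiple of $W^i$, and the symmetric part of $DW$, restricted to the orthogonal complement of $W$, is at each point a multiple of $h$. 2. Its twist and divergence are \[ \ast_h(e^3\wedge de^3)=\frac{\cos\alpha}{V},\qquad \ast_h d\ast_h e^3=-\frac{2\sin\alpha}{V}. \] 3. They are constant multiples of each other: if $\sin\alpha\ne0$ the twist is a constant multiple of the divergence, and if $\cos\alpha\neq0$ the divergence is a constant multiple of the twist. 4. Each of them solves the generalised monopole equation: for $T$ equal to the twist or to the divergence, $T$ is smooth and there is a smooth one-form $\omega$ on $U$ with $\ast_h\big(dT+\tfrac12\nu T\big)=d\omega$. -/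

import Mathlib

open scoped ContDiff

noncomputable section

namespace EW

/-! Tensor calculus in a chart of a three-dimensional space, in components with respect to the
coordinates `(x, y, v)`; the complex coordinate is `w = x + i y`. -/

/-- Points of the chart: `p 0 = x`, `p 1 = y`, `p 2 = v`. -/
abbrev Pt : Type := Fin 3 → ℝ

/-- One-forms, by components. -/
abbrev Form1 : Type := Pt → Fin 3 → ℝ

/-- Two-forms, by components (`σ = ½ σ_{ij} dxⁱ ∧ dxʲ`, `σ_{ij}` skew). -/
abbrev Form2 : Type := Pt → Fin 3 → Fin 3 → ℝ

/-- Three-forms, by components (totally skew). -/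
abbrev Form3 : Type := Pt → Fin 3 → Fin 3 → Fin 3 → ℝ

/-- Vector fields, by components. -/
abbrev VField : Type := Pt → Fin 3 → ℝ

/-- The partial derivative in the `i`-th coordinate. -/
def pd {E : Type*} [NormedAddCommGroup E] [NormedSpace ℝ E] (i : Fin 3) (f : Pt → E) : Pt → E :=
  fun p => fderiv ℝ f p (Pi.single i 1)

/-- Exterior derivative of a function. -/
def d0 (f : Pt → ℝ) : Form1 := fun p i => pd i f p

/-- Exterior derivative of a one-form. -/
def d1 (β : Form1) : Form2 := fun p i j => pd i (fun q => β q j) p - pd j (fun q => β q i) p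

/-- Exterior derivative of a two-form. -/
def d2 (σ : Form2) : Form3 := fun p i j k =>
  pd i (fun q => σ q j k) p + pd j (fun q => σ q k i) p + pd k (fun q => σ q i j) p

/-- Wedge product of a one-form and a two-form. -/
def wedge12 (β : Form1) (σ : Form2) : Form3 := fun p i j k =>
  β p i * σ p j k + β p j * σ p k i + β p k * σ p i j

/-- A coframe `(e¹, e², e³)`: row `a` of `θ p` holds the components of the one-form `eᵃ` at `p`. -/
abbrev Coframe : Type := Pt → Matrix (Fin 3) (Fin 3) ℝ

/-- The metric `h = (e¹)² + (e²)² + (e³)²` for which the coframe is orthonormal. -/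
def metric (θ : Coframe) (p : Pt) : Matrix (Fin 3) (Fin 3) ℝ :=
  Matrix.of fun i j => ∑ a, θ p a i * θ p a j

/-- The inverse metric `h^{ij}`. -/
def invMetric (θ : Coframe) (p : Pt) : Matrix (Fin 3) (Fin 3) ℝ := (metric θ p)⁻¹

/-- The volume form `e¹ ∧ e² ∧ e³`. -/
def vol (θ : Coframe) : Form3 := fun p i j k =>
  Matrix.det (Matrix.of fun a b => θ p a ((![i, j, k] : Fin 3 → Fin 3) b))

/-- Hodge dual of a one-form, `(*β)_{jk} = β^i vol_{ijk}`. -/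
def star1 (θ : Coframe) (β : Form1) : Form2 := fun p j k =>
  ∑ i, ∑ l, invMetric θ p i l * β p l * vol θ p i j k

/-- Hodge dual of a three-form, `*μ = (1/6) μ^{ijk} vol_{ijk}`. -/
def star3 (θ : Coframe) (μ : Form3) : Pt → ℝ := fun p =>
  (1 / 6) * ∑ i, ∑ j, ∑ k, ∑ a, ∑ b, ∑ c,
    invMetric θ p i a * invMetric θ p j b * invMetric θ p k c * μ p a b c * vol θ p i j k

/-- The vector field metrically dual to a one-form, `W^i = h^{ij} β_j`. -/
def sharp (θ : Coframe) (β : Form1) : VField := fun p i => ∑ j, invMetric θ p i j * β p j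

/-- The inner product `h(X, Y)` at `p`. -/
def inner (θ : Coframe) (p : Pt) (X Y : Fin 3 → ℝ) : ℝ := ∑ i, ∑ j, metric θ p i j * X i * Y j

/-- Christoffel symbols `Γ^i_{jk}` of the Levi-Civita connection of `h`. -/
def christoffel (θ : Coframe) (p : Pt) (i j k : Fin 3) : ℝ :=
  (1 / 2) * ∑ l, invMetric θ p i l *
    (pd j (fun q => metric θ q l k) p + pd k (fun q => metric θ q l j) p
      - pd l (fun q => metric θ q j k) p)

/-- `γ^i_{jk} = -δ^i_{(j} ν_{k)} + ½ h_{jk} h^{im} ν_m`, the difference between the Weyl connection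
`D` (torsion-free with `D h = ν ⊗ h`) and the Levi-Civita connection of `h`. -/
def weylDiff (θ : Coframe) (ν : Form1) (p : Pt) (i j k : Fin 3) : ℝ :=
  -(1 / 2) * ((if i = j then ν p k else 0) + (if i = k then ν p j else 0))
    + (1 / 2) * metric θ p j k * ∑ m, invMetric θ p i m * ν p m

/-- The Weyl covariant derivative `D_j W^i` of a vector field. -/
def weylD (θ : Coframe) (ν : Form1) (W : VField) (p : Pt) (j i : Fin 3) : ℝ :=
  pd j (fun q => W q i) p + ∑ k, (christoffel θ p i j k + weylDiff θ ν p i j k) * W p k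

/-- The covariant derivative `D_X W` at `p`. -/
def weylDAlong (θ : Coframe) (ν : Form1) (W : VField) (p : Pt) (X : Fin 3 → ℝ) : Fin 3 → ℝ :=
  fun i => ∑ j, X j * weylD θ ν W p j i

/-- The vector field `W` generates a shear-free geodesic congruence of the Weyl structure `(h, ν)`
in the region `U`: `W` is smooth and nowhere zero, `W^j D_j W^i ∼ W^i`, and the symmetric part of
`D W`, restricted to the orthogonal complement of `W`, is a multiple of the metric. -/
structure IsShearFreeGeodesicCongruence (U : Set Pt) (θ : Coframe) (ν : Form1) (W : VField) :
    Prop where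
  smooth : ContDiffOn ℝ ∞ W U
  ne_zero : ∀ p ∈ U, W p ≠ 0
  geodesic : ∀ p ∈ U, ∃ c : ℝ, weylDAlong θ ν W p (W p) = c • W p
  shear_free : ∀ p ∈ U, ∃ c : ℝ, ∀ X Y : Fin 3 → ℝ,
    inner θ p X (W p) = 0 → inner θ p Y (W p) = 0 →
      inner θ p (weylDAlong θ ν W p X) Y + inner θ p (weylDAlong θ ν W p Y) X = c * inner θ p X Y

/-- `*_h (β ∧ dβ)`. -/
def twist (θ : Coframe) (β : Form1) : Pt → ℝ := star3 θ (wedge12 β (d1 β))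

/-- `*_h d *_h β`. -/
def divergence (θ : Coframe) (β : Form1) : Pt → ℝ := star3 θ (d2 (star1 θ β))

/-- The function `T` solves the generalised monopole equation `*_h (dT + ½ ν T) = dA` in `U`
for some one-form `A`. -/
def SolvesMonopole (U : Set Pt) (θ : Coframe) (ν : Form1) (T : Pt → ℝ) : Prop :=
  ContDiffOn ℝ ∞ T U ∧ ∃ A : Form1, ContDiffOn ℝ ∞ A U ∧
    ∀ p ∈ U, star1 θ (fun q i => d0 T q i + (1 / 2) * ν q i * T q) p = d1 A p

/-! The Einstein-Weyl structures given by a real function `F(w, w̄, v)` and a real constant `α`. -/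

/-- `∂f/∂w`. -/
def pw (f : Pt → ℂ) : Pt → ℂ := fun p => (pd 0 f p - Complex.I * pd 1 f p) / 2

/-- `∂f/∂w̄`. -/
def pwbar (f : Pt → ℂ) : Pt → ℂ := fun p => (pd 0 f p + Complex.I * pd 1 f p) / 2

/-- A real function, regarded as complex valued. -/
def toC (F : Pt → ℝ) : Pt → ℂ := fun p => (F p : ℂ)

/-- `(F cos²α + F_vv) F_{ww̄} - (F_w̄ cos α - i F_{vw̄}) (F_w cos α + i F_{vw}) = 4 e^{-2 v sin α}`
at `p`. -/
def FieldEquation (α : ℝ) (F : Pt → ℝ) (p : Pt) : Prop :=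
  ((F p * Real.cos α ^ 2 + pd 2 (pd 2 F) p : ℝ) : ℂ) * pw (pwbar (toC F)) p
    - (pwbar (toC F) p * (Real.cos α : ℂ) - Complex.I * pwbar (pd 2 (toC F)) p)
      * (pw (toC F) p * (Real.cos α : ℂ) + Complex.I * pw (pd 2 (toC F)) p)
    = ((4 * Real.exp (-2 * p 2 * Real.sin α) : ℝ) : ℂ)

/-- `4 V = F cos²α + F_vv`. -/
def V (α : ℝ) (F : Pt → ℝ) : Pt → ℝ := fun p => (F p * Real.cos α ^ 2 + pd 2 (pd 2 F) p) / 4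

/-- `2 S = F_w cos α + i F_{vw}`. -/
def S (α : ℝ) (F : Pt → ℝ) : Pt → ℂ := fun p =>
  (pw (toC F) p * (Real.cos α : ℂ) + Complex.I * pw (pd 2 (toC F)) p) / 2

/-- Components of `dw`. -/
def dw : Fin 3 → ℂ := ![1, Complex.I, 0]

/-- Components of `dw̄`. -/
def dwbar : Fin 3 → ℂ := ![1, -Complex.I, 0]

/-- Components of `dv`. -/
def dv : Fin 3 → ℂ := ![0, 0, 1]

/-- The constant `m = e^{iα}`. -/
def m (α : ℝ) : ℂ := Complex.exp (Complex.I * (α : ℂ))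

/-- `e¹ = ½ (e^{imv} dw + e^{-im̄v} dw̄)`; the expression equals its conjugate, so that taking the
real part only changes its type (likewise in the next three definitions). -/
def e1 (α : ℝ) : Form1 := fun p j =>
  ((1 / 2) * (Complex.exp (Complex.I * m α * (p 2 : ℂ)) * dw j
    + Complex.exp (-Complex.I * star (m α) * (p 2 : ℂ)) * dwbar j)).re

/-- `e² = (i/2) (e^{-im̄v} dw̄ - e^{imv} dw)`. -/
def e2 (α : ℝ) : Form1 := fun p j =>
  ((Complex.I / 2) * (Complex.exp (-Complex.I * star (m α) * (p 2 : ℂ)) * dwbar j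
    - Complex.exp (Complex.I * m α * (p 2 : ℂ)) * dw j)).re

/-- `e³ = V dv - (i/2) (S dw - S̄ dw̄)`. -/
def e3 (α : ℝ) (F : Pt → ℝ) : Form1 := fun p j =>
  ((V α F p : ℂ) * dv j - (Complex.I / 2) * (S α F p * dw j - star (S α F p) * dwbar j)).re

/-- `ν = (cos α (S dw + S̄ dw̄) - 2 i sin α (S̄ dw̄ - S dw)) / V - 4 sin α dv`. -/
def nu (α : ℝ) (F : Pt → ℝ) : Form1 := fun p j =>
  (((Real.cos α : ℂ) * (S α F p * dw j + star (S α F p) * dwbar j)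
      - 2 * Complex.I * (Real.sin α : ℂ) * (star (S α F p) * dwbar j - S α F p * dw j))
      / (V α F p : ℂ)
    - 4 * (Real.sin α : ℂ) * dv j).re

/-- The orthonormal coframe `(e¹, e², e³)`; its metric is
`h = e^{-2 v sin α} dw dw̄ + (V dv - (i/2) (S dw - S̄ dw̄))²`. -/
def coframe (α : ℝ) (F : Pt → ℝ) : Coframe := fun p => Matrix.of ![e1 α p, e2 α p, e3 α F p]

end EW

end

/-!
Write `c = cos α` and `s = sin α`. The definitions of `V` and `S` factor through `c ± i ∂_v`:
`4V = (c - i ∂_v)(c + i ∂_v) F` and `2S = (c + i ∂_v) F_w`. Commuting derivatives therefore gives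
the linear identities `dV = ∂_v e³ + c σ`, where `σ = Re (S dw)`, and, as vectors dual to two-forms,
`de³ = c (-Im S, -Re S, F_{ww̄})`. The field equation reads `V F_{ww̄} - |S|² = ρ` with
`ρ = e^{-2sv}`, so that `V ≠ 0`. The metric is `ρ dw dw̄ + e³ ⊗ e³`, with volume density `ρ V`,
whence `W = ∂_v / V` has unit length; twist and divergence are then read off from `de³` and from
the density `ρ V W = ρ ∂_v`.

For a unit field the lowered acceleration is `i_W dβ + ½ ν - ν(W) β` with `β` dual to `W`, and here
the `σ`-parts of `i_W de³` and `½ ν` cancel, leaving a multiple of `e³`. The symmetric part of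
`D W` is given by `L_W h - ν(W) h`, and on the complement of `W` the flow of `W` only rescales the
transverse metric `ρ dw dw̄`: no shear.

For `T = k / V` the one-form `-T σ` is a monopole potential; checking this uses the field equation
and its `v`-derivative.
-/

namespace EW

open Matrix Topology

section PartialDerivatives

variable {E G : Type*} [NormedAddCommGroup E] [NormedSpace ℝ E] [NormedAddCommGroup G]
  [NormedSpace ℝ G] {p : Pt}

theorem pd_congr {f g : Pt → E} (h : f =ᶠ[𝓝 p] g) (i : Fin 3) : pd i f p = pd i g p := by
  rw [pd, pd, h.fderiv_eq]

theorem pd_const (i : Fin 3) (c : E) : pd i (fun _ => c) p = 0 := by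
  simp [pd]

theorem pd_add {f g : Pt → E} (hf : DifferentiableAt ℝ f p) (hg : DifferentiableAt ℝ g p)
    (i : Fin 3) : pd i (fun q => f q + g q) p = pd i f p + pd i g p := by
  simp [pd, fderiv_fun_add hf hg]

theorem pd_sub {f g : Pt → E} (hf : DifferentiableAt ℝ f p) (hg : DifferentiableAt ℝ g p)
    (i : Fin 3) : pd i (fun q => f q - g q) p = pd i f p - pd i g p := by
  simp [pd, fderiv_fun_sub hf hg]

theorem pd_neg (f : Pt → E) (i : Fin 3) : pd i (fun q => -f q) p = -pd i f p := by
  simp [pd, fderiv_fun_neg]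

theorem pd_mul {A : Type*} [NormedCommRing A] [NormedAlgebra ℝ A] {f g : Pt → A}
    (hf : DifferentiableAt ℝ f p) (hg : DifferentiableAt ℝ g p) (i : Fin 3) :
    pd i (fun q => f q * g q) p = pd i f p * g p + f p * pd i g p := by
  simp only [pd, fderiv_fun_mul hf hg, _root_.add_apply, _root_.smul_apply, smul_eq_mul]
  ring

theorem pd_const_mul {A : Type*} [NormedCommRing A] [NormedAlgebra ℝ A] {f : Pt → A}
    (hf : DifferentiableAt ℝ f p) (c : A) (i : Fin 3) :
    pd i (fun q => c * f q) p = c * pd i f p := by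
  rw [pd_mul (differentiableAt_const c) hf, pd_const, zero_mul, zero_add]

theorem pd_dotProduct {f g : Pt → Fin 3 → ℝ} (hf : ∀ k, DifferentiableAt ℝ (fun q => f q k) p)
    (hg : ∀ k, DifferentiableAt ℝ (fun q => g q k) p) (i : Fin 3) :
    pd i (fun q => f q ⬝ᵥ g q) p =
      ∑ k, (pd i (fun q => f q k) p * g p k + f p k * pd i (fun q => g q k) p) := by
  have hfg (k : Fin 3) : DifferentiableAt ℝ (fun q => f q k * g q k) p := (hf k).fun_mul (hg k)
  simp only [dotProduct, Fin.sum_univ_three]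
  rw [pd_add ((hfg 0).fun_add (hfg 1)) (hfg 2), pd_add (hfg 0) (hfg 1)]
  simp only [pd_mul (hf _) (hg _)]

theorem pd_div_const {A : Type*} [NormedField A] [NormedAlgebra ℝ A] {f : Pt → A}
    (hf : DifferentiableAt ℝ f p) (c : A) (i : Fin 3) :
    pd i (fun q => f q / c) p = pd i f p / c := by
  simp only [div_eq_inv_mul, pd_const_mul hf]

theorem pd_const_div {f : Pt → ℝ} (hf : DifferentiableAt ℝ f p) (h0 : f p ≠ 0) (k : ℝ)
    (i : Fin 3) : pd i (fun q => k / f q) p = -(k / f p ^ 2) * pd i f p := by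
  have h : HasFDerivAt (fun q => k / f q) ((-(k / f p ^ 2)) • fderiv ℝ f p) p :=
    ((hasDerivAt_const (f p) k).fun_div (hasDerivAt_id (f p)) h0).comp_hasFDerivAt p
      hf.hasFDerivAt |>.congr_fderiv (by ext; simp [neg_div])
  rw [pd, h.fderiv, _root_.smul_apply, smul_eq_mul, pd]

theorem pd_clm_comp (L : E →L[ℝ] G) {f : Pt → E} (hf : DifferentiableAt ℝ f p) (i : Fin 3) :
    pd i (fun q => L (f q)) p = L (pd i f p) := by
  have h : HasFDerivAt (fun q => L (f q)) (L ∘L fderiv ℝ f p) p :=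
    L.hasFDerivAt.comp p hf.hasFDerivAt
  rw [pd, h.fderiv, ContinuousLinearMap.comp_apply, pd]

theorem contDiffAt_vec3 {n : WithTop ℕ∞} {f g h : Pt → ℝ} (hf : ContDiffAt ℝ n f p)
    (hg : ContDiffAt ℝ n g p) (hh : ContDiffAt ℝ n h p) :
    ContDiffAt ℝ n (fun q => ![f q, g q, h q]) p := by
  rw [contDiffAt_pi]
  exact Fin.forall_fin_succ.2 ⟨hf, Fin.forall_fin_two.2 ⟨hg, hh⟩⟩

theorem contDiffAt_pd {n : WithTop ℕ∞} {f : Pt → E} (hf : ContDiffAt ℝ (n + 1) f p)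
    (i : Fin 3) : ContDiffAt ℝ n (pd i f) p :=
  (hf.fderiv_right le_rfl).clm_apply contDiffAt_const

theorem differentiableAt_pd {f : Pt → E} (hf : ContDiffAt ℝ 2 f p) (i : Fin 3) :
    DifferentiableAt ℝ (pd i f) p :=
  (contDiffAt_pd (n := 1) hf i).differentiableAt one_ne_zero

theorem differentiableAt_pd_pd {f : Pt → E} (hf : ContDiffAt ℝ 3 f p) (i j : Fin 3) :
    DifferentiableAt ℝ (pd i (pd j f)) p :=
  differentiableAt_pd (contDiffAt_pd (n := 2) hf j) i

theorem pd_comm {f : Pt → E} (hf : ContDiffAt ℝ 2 f p) (i j : Fin 3) :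
    pd i (pd j f) p = pd j (pd i f) p := by
  have hd : DifferentiableAt ℝ (fderiv ℝ f) p :=
    (hf.fderiv_right (m := 1) (by norm_num)).differentiableAt one_ne_zero
  have pd_pd (i j : Fin 3) : pd i (pd j f) p =
      fderiv ℝ (fderiv ℝ f) p (Pi.single i 1) (Pi.single j 1) := by
    unfold pd
    simp [fderiv_clm_apply hd (differentiableAt_const (Pi.single j 1))]
  rw [pd_pd, pd_pd]
  exact hf.isSymmSndFDerivAt (by simp) _ _

end PartialDerivatives

section Alternating

/-- A three-form at a point: total skew-symmetry of an array of components. -/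
def IsAlternating (μ : Fin 3 → Fin 3 → Fin 3 → ℝ) : Prop :=
  (∀ i j k, μ i j k = -μ j i k) ∧ ∀ i j k, μ i j k = -μ i k j

/-- The Levi-Civita symbol `ε_{ijk}`, as a normalised Vandermonde product of the indices. -/
noncomputable def leviCivita (i j k : Fin 3) : ℝ :=
  ((j : ℝ) - i) * ((k : ℝ) - i) * ((k : ℝ) - j) / 2

/-- The vector `(σ₁₂, σ₂₀, σ₀₁)` encoding a two-form at a point; for `σ = dβ` it is the coordinate
curl of `β`. -/
def dualVec (σ : Fin 3 → Fin 3 → ℝ) : Fin 3 → ℝ := ![σ 1 2, σ 2 0, σ 0 1]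

theorem IsAlternating.eq_mul_leviCivita {μ : Fin 3 → Fin 3 → Fin 3 → ℝ} (h : IsAlternating μ)
    (i j k : Fin 3) : μ i j k = μ 0 1 2 * leviCivita i j k := by
  obtain ⟨h₁, h₂⟩ := h
  have hiik (i k) : μ i i k = 0 := by linarith [h₁ i i k]
  have hikk (i k) : μ i k k = 0 := by linarith [h₂ i k k]
  have hiki (i k) : μ i k i = 0 := by linarith [h₂ i k i, hiik i k]
  fin_cases i <;> fin_cases j <;> fin_cases k <;> dsimp only [Fin.reduceFinMk] <;>
    norm_num [hiik, hikk, hiki, leviCivita] <;>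
    linarith [h₁ 1 0 2, h₂ 0 2 1, h₂ 1 2 0, h₁ 2 0 1, h₂ 2 1 0, h₁ 1 2 0]

theorem ext_dualVec {σ τ : Fin 3 → Fin 3 → ℝ} (hσ : ∀ i j, σ i j = -σ j i)
    (hτ : ∀ i j, τ i j = -τ j i) (h : dualVec σ = dualVec τ) : σ = τ := by
  have h12 : σ 1 2 = τ 1 2 := congrFun h 0
  have h20 : σ 2 0 = τ 2 0 := congrFun h 1
  have h01 : σ 0 1 = τ 0 1 := congrFun h 2
  ext i j
  fin_cases i <;> fin_cases j <;> dsimp <;>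
    linarith [hσ 0 0, hσ 1 1, hσ 2 2, hσ 1 0, hσ 2 1, hσ 0 2,
      hτ 0 0, hτ 1 1, hτ 2 2, hτ 1 0, hτ 2 1, hτ 0 2]

theorem d1_skew (β : Form1) (p : Pt) (i j : Fin 3) : d1 β p i j = -d1 β p j i := by
  rw [d1, d1, neg_sub]

theorem isAlternating_wedge12 (β : Form1) {σ : Form2} {p : Pt} (h : ∀ i j, σ p i j = -σ p j i) :
    IsAlternating (wedge12 β σ p) := by
  refine ⟨fun i j k => ?_, fun i j k => ?_⟩ <;> unfold wedge12 <;>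
    linear_combination β p i * h j k + β p j * h k i + β p k * h i j

theorem isAlternating_d2 {σ : Form2} (h : ∀ p i j, σ p i j = -σ p j i) (p : Pt) :
    IsAlternating (d2 σ p) := by
  have pd_skew (i j k) : pd i (fun q => σ q j k) p = -pd i (fun q => σ q k j) p := by
    simp [pd, funext fun q => h q j k]
  refine ⟨fun i j k => ?_, fun i j k => ?_⟩ <;> unfold d2 <;>
    linear_combination pd_skew i j k + pd_skew j k i + pd_skew k i j

theorem isAlternating_vol (θ : Coframe) (p : Pt) : IsAlternating (vol θ p) := by
  refine ⟨fun i j k => ?_, fun i j k => ?_⟩ <;>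
    simp only [vol, det_fin_three, of_apply, cons_val] <;> ring

theorem vol_eq (θ : Coframe) (p : Pt) (i j k : Fin 3) :
    vol θ p i j k = (θ p).det * leviCivita i j k := by
  rw [(isAlternating_vol θ p).eq_mul_leviCivita i j k]
  simp [vol, det_fin_three]

theorem dualVec_d1_mul {f : Pt → ℝ} {β : Form1} {p : Pt} (hf : DifferentiableAt ℝ f p)
    (hβ : DifferentiableAt ℝ β p) :
    dualVec (d1 (fun q i => f q * β q i) p) =
      f p • dualVec (d1 β p) + d0 f p ⨯₃ β p := by
  have hβ' (j) : DifferentiableAt ℝ (fun q => β q j) p := differentiableAt_pi.1 hβ j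
  ext i
  fin_cases i <;> simp [dualVec, d1, d0, pd_mul hf (hβ' _), cross_apply] <;> ring

theorem sum_mul_d1 (β : Form1) (p : Pt) (X : Fin 3 → ℝ) :
    (fun n => ∑ j, X j * d1 β p j n) = dualVec (d1 β p) ⨯₃ X := by
  ext n
  fin_cases n <;> simp [dualVec, d1, cross_apply, Fin.sum_univ_three] <;> ring

end Alternating

section Hodge

variable {θ : Coframe} {p : Pt}

theorem metric_eq_transpose_mul (θ : Coframe) (p : Pt) : metric θ p = (θ p)ᵀ * θ p := rfl

theorem metric_comm (θ : Coframe) (p : Pt) (i j : Fin 3) : metric θ p i j = metric θ p j i := by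
  simp only [metric, of_apply, mul_comm]

theorem det_invMetric (θ : Coframe) (p : Pt) : (invMetric θ p).det = ((θ p).det ^ 2)⁻¹ := by
  rw [invMetric, metric_eq_transpose_mul, det_nonsing_inv, det_mul, det_transpose, ← sq,
    Ring.inverse_eq_inv]

theorem isUnit_det_metric (hθ : (θ p).det ≠ 0) : IsUnit (metric θ p).det := by
  rw [metric_eq_transpose_mul, det_mul, det_transpose]
  exact (mul_ne_zero hθ hθ).isUnit

theorem metric_mulVec_invMetric (hθ : (θ p).det ≠ 0) (β : Fin 3 → ℝ) :
    metric θ p *ᵥ (invMetric θ p *ᵥ β) = β := by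
  rw [mulVec_mulVec, invMetric, mul_nonsing_inv _ (isUnit_det_metric hθ), one_mulVec]

theorem metric_mulVec_injective (hθ : (θ p).det ≠ 0) :
    Function.Injective (metric θ p).mulVec :=
  mulVec_injective_of_isUnit ((isUnit_iff_isUnit_det _).2 (isUnit_det_metric hθ))

theorem sharp_eq_of_metric_mulVec_eq (hθ : (θ p).det ≠ 0) {β : Form1} {X : Fin 3 → ℝ}
    (h : metric θ p *ᵥ X = β p) : sharp θ β p = X :=
  metric_mulVec_injective hθ ((metric_mulVec_invMetric hθ (β p)).trans h.symm)

theorem inner_eq_dotProduct (θ : Coframe) (p : Pt) (X Y : Fin 3 → ℝ) :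
    inner θ p X Y = X ⬝ᵥ metric θ p *ᵥ Y := by
  simp only [inner, dotProduct, mulVec, Finset.mul_sum]
  exact Finset.sum_congr rfl fun i _ => Finset.sum_congr rfl fun j _ => by ring

theorem inner_comm (θ : Coframe) (p : Pt) (X Y : Fin 3 → ℝ) :
    inner θ p X Y = inner θ p Y X := by
  rw [inner_eq_dotProduct, inner_eq_dotProduct, dotProduct_comm, ← vecMul_transpose,
    dotProduct_mulVec, metric_eq_transpose_mul, transpose_mul, transpose_transpose]

theorem star3_eq_div_det {μ : Form3} (hμ : IsAlternating (μ p)) :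
    star3 θ μ p = μ p 0 1 2 / (θ p).det := by
  have contraction : star3 θ μ p = (invMetric θ p).det * ((θ p).det * μ p 0 1 2) := by
    have hμ' : μ p = fun i j k => μ p 0 1 2 * leviCivita i j k := by
      ext i j k
      exact hμ.eq_mul_leviCivita i j k
    generalize μ p 0 1 2 = c at hμ' ⊢
    simp only [star3, vol_eq, hμ', det_fin_three (invMetric θ p), Fin.sum_univ_three, leviCivita]
    norm_num
    ring
  rw [contraction, det_invMetric]
  rcases eq_or_ne (θ p).det 0 with h | h
  · simp [h]
  · field_simp

theorem star1_skew (θ : Coframe) (β : Form1) (p : Pt) (j k : Fin 3) :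
    star1 θ β p j k = -star1 θ β p k j := by
  simp only [star1, ← Finset.sum_neg_distrib, (isAlternating_vol θ p).2 _ j k, mul_neg]

theorem dualVec_star1 (θ : Coframe) (β : Form1) (p : Pt) :
    dualVec (star1 θ β p) = (θ p).det • sharp θ β p := by
  ext i
  fin_cases i <;>
    simp [dualVec, star1, sharp, vol_eq, leviCivita, Fin.sum_univ_three] <;> ring

theorem star1_eq_of_metric_mulVec_dualVec (hθ : (θ p).det ≠ 0) {β : Form1}
    {σ : Fin 3 → Fin 3 → ℝ} (hσ : ∀ i j, σ i j = -σ j i)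
    (h : metric θ p *ᵥ dualVec σ = (θ p).det • β p) : star1 θ β p = σ := by
  refine ext_dualVec (star1_skew θ β p) hσ ?_
  have hβ : metric θ p *ᵥ ((θ p).det⁻¹ • dualVec σ) = β p := by
    rw [mulVec_smul, h, inv_smul_smul₀ hθ]
  rw [dualVec_star1, sharp_eq_of_metric_mulVec_eq hθ hβ, smul_inv_smul₀ hθ]

theorem twist_eq (θ : Coframe) (β : Form1) (p : Pt) :
    twist θ β p = β p ⬝ᵥ dualVec (d1 β p) / (θ p).det := by
  rw [twist, star3_eq_div_det (isAlternating_wedge12 β (d1_skew β p))]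
  simp only [wedge12, dotProduct, dualVec, Fin.sum_univ_three, cons_val]

theorem divergence_eq (θ : Coframe) (β : Form1) (p : Pt) :
    divergence θ β p =
      (∑ i, pd i (fun q => (θ q).det * sharp θ β q i) p) / (θ p).det := by
  have hdual (i : Fin 3) :
      (fun q => (θ q).det * sharp θ β q i) = fun q => dualVec (star1 θ β q) i := by
    ext q
    rw [dualVec_star1, Pi.smul_apply, smul_eq_mul]
  rw [divergence, star3_eq_div_det (isAlternating_d2 (star1_skew θ β) p)]
  simp [hdual, d2, dualVec, Fin.sum_univ_three]

end Hodge

section Congruence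

variable {θ : Coframe} {ν β : Form1} {W : VField} {p : Pt}

/-- The Lie derivative `(L_W h)_{ij} = W^k ∂_k h_{ij} + h_{jk} ∂_i W^k + h_{ik} ∂_j W^k` of the
metric, which carries the symmetric part of the covariant derivative of `W`. -/
noncomputable def lieMetric (θ : Coframe) (W : VField) (p : Pt) : Matrix (Fin 3) (Fin 3) ℝ :=
  Matrix.of fun i j => ∑ k, (W p k * pd k (fun q => metric θ q i j) p
    + metric θ p j k * pd i (fun q => W q k) p + metric θ p i k * pd j (fun q => W q k) p)

theorem metric_mulVec_weylD (hθ : (θ p).det ≠ 0) (ν : Form1) (W : VField) (j n : Fin 3) :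
    (metric θ p *ᵥ weylD θ ν W p j) n =
      ∑ k, (metric θ p n k * pd j (fun q => W q k) p +
        (pd j (fun q => metric θ q n k) p + pd k (fun q => metric θ q n j) p
          - pd n (fun q => metric θ q j k) p) / 2 * W p k)
      - ((ν p ⬝ᵥ W p) * metric θ p n j + ν p j * (metric θ p *ᵥ W p) n) / 2
      + (metric θ p *ᵥ W p) j * ν p n / 2 := by
  set b : Fin 3 → ℝ := fun l =>
    ∑ k, (pd j (fun q => metric θ q l k) p + pd k (fun q => metric θ q l j) p
      - pd l (fun q => metric θ q j k) p) / 2 * W p k with hb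
  have raised : weylD θ ν W p j =
      (fun i => pd j (fun q => W q i) p) + invMetric θ p *ᵥ b
        - (1 / 2 : ℝ) • ((ν p ⬝ᵥ W p) • Pi.single j 1 + ν p j • W p)
        + ((metric θ p *ᵥ W p) j / 2) • invMetric θ p *ᵥ ν p := by
    ext i
    simp only [weylD, christoffel, weylDiff, mulVec, dotProduct, hb, Pi.add_apply, Pi.sub_apply,
      Pi.smul_apply, smul_eq_mul, Pi.single_apply, Fin.sum_univ_three]
    fin_cases i <;> fin_cases j <;> simp <;> ring
  rw [raised]
  simp only [mulVec_add, mulVec_sub, mulVec_smul, metric_mulVec_invMetric hθ, mulVec_single_one,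
    Pi.add_apply, Pi.sub_apply, Pi.smul_apply, smul_eq_mul, col_apply, Finset.sum_add_distrib, hb]
  simp only [mulVec, dotProduct]
  ring

theorem metric_mulVec_weylDAlong (θ : Coframe) (ν : Form1) (W : VField) (p : Pt)
    (X : Fin 3 → ℝ) (n : Fin 3) :
    (metric θ p *ᵥ weylDAlong θ ν W p X) n =
      ∑ j, X j * (metric θ p *ᵥ weylD θ ν W p j) n := by
  simp only [weylDAlong, mulVec, dotProduct, Fin.sum_univ_three]
  ring

theorem metric_mulVec_weylD_add_swap (hθ : (θ p).det ≠ 0) (ν : Form1) (W : VField)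
    (j n : Fin 3) :
    (metric θ p *ᵥ weylD θ ν W p j) n + (metric θ p *ᵥ weylD θ ν W p n) j =
      lieMetric θ W p j n - (ν p ⬝ᵥ W p) * metric θ p j n := by
  have pd_metric_comm (k : Fin 3) :
      pd k (fun q => metric θ q n j) p = pd k (fun q => metric θ q j n) p := by
    simp only [metric_comm θ _ n j]
  simp only [metric_mulVec_weylD hθ, lieMetric, of_apply, Fin.sum_univ_three, pd_metric_comm,
    metric_comm θ p n j]
  ring

theorem inner_weylDAlong_add_swap (hθ : (θ p).det ≠ 0) (ν : Form1) (W : VField)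
    (X Y : Fin 3 → ℝ) :
    inner θ p (weylDAlong θ ν W p X) Y + inner θ p (weylDAlong θ ν W p Y) X =
      X ⬝ᵥ lieMetric θ W p *ᵥ Y - (ν p ⬝ᵥ W p) * inner θ p X Y := by
  have inner_weylDAlong (X Y : Fin 3 → ℝ) : inner θ p (weylDAlong θ ν W p X) Y =
      ∑ j, ∑ n, X j * Y n * (metric θ p *ᵥ weylD θ ν W p j) n := by
    rw [inner_comm, inner_eq_dotProduct, dotProduct]
    simp only [metric_mulVec_weylDAlong, Finset.mul_sum]
    rw [Finset.sum_comm]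
    exact Finset.sum_congr rfl fun j _ => Finset.sum_congr rfl fun n _ => by ring
  have hsum : ∑ j, ∑ n, X j * Y n * ((metric θ p *ᵥ weylD θ ν W p j) n
      + (metric θ p *ᵥ weylD θ ν W p n) j) =
      ∑ j, ∑ n, X j * Y n * (lieMetric θ W p j n - (ν p ⬝ᵥ W p) * metric θ p j n) := by
    simp only [metric_mulVec_weylD_add_swap hθ]
  rw [inner_weylDAlong, inner_weylDAlong, inner_eq_dotProduct]
  simp only [mulVec, dotProduct, Fin.sum_univ_three] at hsum ⊢
  linear_combination hsum

theorem pd_metric_mulVec (hg : ∀ i j, DifferentiableAt ℝ (fun q => metric θ q i j) p)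
    (hW : DifferentiableAt ℝ W p) (hβ : β =ᶠ[𝓝 p] fun q => metric θ q *ᵥ W q) (j n : Fin 3) :
    pd j (fun q => β q n) p = ∑ k, (pd j (fun q => metric θ q n k) p * W p k
      + metric θ p n k * pd j (fun q => W q k) p) := by
  rw [pd_congr (hβ.mono fun q hq => congrFun hq n)]
  exact pd_dotProduct (hg n) (differentiableAt_pi.1 hW) j

theorem sum_mul_pd_metric_of_unit (hg : ∀ i j, DifferentiableAt ℝ (fun q => metric θ q i j) p)
    (hW : DifferentiableAt ℝ W p) (hβ : β =ᶠ[𝓝 p] fun q => metric θ q *ᵥ W q)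
    (hunit : ∀ᶠ q in 𝓝 p, β q ⬝ᵥ W q = 1) (n : Fin 3) :
    ∑ j, W p j * ∑ k, W p k * pd n (fun q => metric θ q j k) p =
      2 * ∑ j, W p j * pd n (fun q => β q j) p := by
  have hβp (l : Fin 3) : ∑ k, metric θ p k l * W p k = β p l := by
    simp only [metric_comm θ p _ l, hβ.self_of_nhds, mulVec, dotProduct]
  have hW' (k : Fin 3) : DifferentiableAt ℝ (fun q => W q k) p := differentiableAt_pi.1 hW k
  have hβ' (k : Fin 3) : DifferentiableAt ℝ (fun q => β q k) p :=
    (DifferentiableAt.fun_sum (u := Finset.univ) fun l _ =>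
      (hg k l).fun_mul (hW' l)).congr_of_eventuallyEq (hβ.mono fun q hq => congrFun hq k)
  have pd_unit : ∑ k, (pd n (fun q => β q k) p * W p k + β p k * pd n (fun q => W q k) p) = 0 := by
    rw [← pd_dotProduct hβ' hW', pd_congr (g := fun _ => (1 : ℝ)) hunit, pd_const]
  have hpd (k : Fin 3) := pd_metric_mulVec hg hW hβ n k
  simp only [Fin.sum_univ_three] at hβp pd_unit hpd ⊢
  linear_combination -pd_unit - W p 0 * hpd 0 - W p 1 * hpd 1 - W p 2 * hpd 2
    - pd n (fun q => W q 0) p * hβp 0 - pd n (fun q => W q 1) p * hβp 1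
    - pd n (fun q => W q 2) p * hβp 2

/-- Differentiating `h(W, W) = 1` turns the acceleration of a unit field into `i_W dβ`, up to the
terms in `ν`. -/
theorem metric_mulVec_weylDAlong_self (hθ : (θ p).det ≠ 0)
    (hg : ∀ i j, DifferentiableAt ℝ (fun q => metric θ q i j) p) (hW : DifferentiableAt ℝ W p)
    (hβ : β =ᶠ[𝓝 p] fun q => metric θ q *ᵥ W q) (hunit : ∀ᶠ q in 𝓝 p, β q ⬝ᵥ W q = 1)
    (ν : Form1) :
    metric θ p *ᵥ weylDAlong θ ν W p (W p) =
      dualVec (d1 β p) ⨯₃ W p + (1 / 2 : ℝ) • ν p - (ν p ⬝ᵥ W p) • β p := by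
  have hβp : metric θ p *ᵥ W p = β p := hβ.self_of_nhds.symm
  rw [← sum_mul_d1]
  ext n
  have hβn : (metric θ p *ᵥ W p) n = β p n := congrFun hβp n
  have hunit_p := hunit.self_of_nhds
  have hpd (j : Fin 3) := pd_metric_mulVec hg hW hβ j n
  have hdg := sum_mul_pd_metric_of_unit hg hW hβ hunit n
  simp only [metric_mulVec_weylDAlong, metric_mulVec_weylD hθ, hβp, d1, Pi.add_apply,
    Pi.sub_apply, Pi.smul_apply, smul_eq_mul]
  simp only [mulVec, dotProduct, Fin.sum_univ_three] at hβn hunit_p hpd hdg ⊢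
  linear_combination ν p n / 2 * hunit_p - hdg / 2
    - (ν p 0 * W p 0 + ν p 1 * W p 1 + ν p 2 * W p 2) / 2 * hβn
    - W p 0 * hpd 0 - W p 1 * hpd 1 - W p 2 * hpd 2

theorem exists_lieMetric_eq {ρ : Pt → ℝ} {G : Matrix (Fin 3) (Fin 3) ℝ}
    (hg : metric θ =ᶠ[𝓝 p] fun q => ρ q • G + vecMulVec (β q) (β q))
    (hGW : ∀ᶠ q in 𝓝 p, G *ᵥ W q = 0)
    (hρ : DifferentiableAt ℝ ρ p) (hβ : DifferentiableAt ℝ β p) (hW : DifferentiableAt ℝ W p) :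
    ∃ ℓ : Fin 3 → ℝ, lieMetric θ W p =
      (d0 ρ p ⬝ᵥ W p) • G + vecMulVec ℓ (β p) + vecMulVec (β p) ℓ := by
  have hW' (k) : DifferentiableAt ℝ (fun q => W q k) p := differentiableAt_pi.1 hW k
  have hβ' (k) : DifferentiableAt ℝ (fun q => β q k) p := differentiableAt_pi.1 hβ k
  have pd_metric (i j k : Fin 3) : pd k (fun q => metric θ q i j) p =
      pd k ρ p * G i j
        + (pd k (fun q => β q i) p * β p j + β p i * pd k (fun q => β q j) p) := by
    have hg' : (fun q => metric θ q i j) =ᶠ[𝓝 p] fun q => ρ q * G i j + β q i * β q j :=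
      hg.mono fun q hq => by simp [hq, vecMulVec_apply]
    rw [pd_congr hg', pd_add (hρ.mul_const _) ((hβ' i).fun_mul (hβ' j)),
      pd_mul hρ (differentiableAt_const _), pd_const, mul_zero, add_zero,
      pd_mul (hβ' i) (hβ' j)]
  have pd_GW (i n : Fin 3) : ∑ k, G n k * pd i (fun q => W q k) p = 0 := by
    have h := pd_dotProduct (f := fun _ => G n) (fun _ => differentiableAt_const _) hW' i
    have hzero : (fun q => G n ⬝ᵥ W q) =ᶠ[𝓝 p] fun _ => 0 := hGW.mono fun q hq => congrFun hq n
    rw [pd_congr hzero, pd_const] at h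
    simpa [pd_const] using h.symm
  have hgp (i j : Fin 3) : metric θ p i j = ρ p * G i j + β p i * β p j := by
    simp [hg.self_of_nhds, vecMulVec_apply]
  refine ⟨fun i => ∑ k, (W p k * pd k (fun q => β q i) p + β p k * pd i (fun q => W q k) p), ?_⟩
  ext i j
  have hi := pd_GW i j
  have hj := pd_GW j i
  simp only [lieMetric, pd_metric, hgp, of_apply, Matrix.add_apply, Matrix.smul_apply,
    vecMulVec_apply, smul_eq_mul, Fin.sum_univ_three, d0, dotProduct] at hi hj ⊢
  linear_combination ρ p * hi + ρ p * hj

theorem inner_weylDAlong_add_swap_of_transverse {ρ : Pt → ℝ} {G : Matrix (Fin 3) (Fin 3) ℝ}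
    (hθ : (θ p).det ≠ 0) (hg : metric θ =ᶠ[𝓝 p] fun q => ρ q • G + vecMulVec (β q) (β q))
    (hGW : ∀ᶠ q in 𝓝 p, G *ᵥ W q = 0) (hρ : DifferentiableAt ℝ ρ p) (hρ0 : ρ p ≠ 0)
    (hβ : DifferentiableAt ℝ β p) (hW : DifferentiableAt ℝ W p) (ν : Form1)
    {X Y : Fin 3 → ℝ} (hX : β p ⬝ᵥ X = 0) (hY : β p ⬝ᵥ Y = 0) :
    inner θ p (weylDAlong θ ν W p X) Y + inner θ p (weylDAlong θ ν W p Y) X =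
      ((d0 ρ p ⬝ᵥ W p) / ρ p - ν p ⬝ᵥ W p) * inner θ p X Y := by
  obtain ⟨ℓ, hℓ⟩ := exists_lieMetric_eq hg hGW hρ hβ hW
  have hXY : inner θ p X Y = ρ p * (X ⬝ᵥ G *ᵥ Y) := by
    rw [inner_eq_dotProduct, hg.self_of_nhds]
    simp [add_mulVec, smul_mulVec, vecMulVec_mulVec, hY]
  have hlie : X ⬝ᵥ lieMetric θ W p *ᵥ Y = (d0 ρ p ⬝ᵥ W p) * (X ⬝ᵥ G *ᵥ Y) := by
    simp [hℓ, add_mulVec, smul_mulVec, vecMulVec_mulVec, hY, dotProduct_comm X, hX]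
  rw [inner_weylDAlong_add_swap hθ, hlie, hXY]
  field_simp

end Congruence

section FieldData

variable {α : ℝ} {F : Pt → ℝ} {p : Pt}

/-- The conformal factor `e^{-2 v sin α}` of `dw dw̄` in the metric. -/
noncomputable def conf (α : ℝ) : Pt → ℝ := fun p => Real.exp (-2 * p 2 * Real.sin α)

/-- The real one-form `Re (S dw)`, the potential of the monopoles up to a function factor. -/
noncomputable def reSdw (α : ℝ) (F : Pt → ℝ) : Form1 := fun p =>
  ![(S α F p).re, -(S α F p).im, 0]

/-- `F_{w w̄}`, as a real function. -/
noncomputable def lap (F : Pt → ℝ) : Pt → ℝ := fun p => (pd 0 (pd 0 F) p + pd 1 (pd 1 F) p) / 4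

theorem contDiffAt_toC {n : WithTop ℕ∞} (hF : ContDiffAt ℝ n F p) : ContDiffAt ℝ n (toC F) p :=
  Complex.ofRealCLM.contDiff.contDiffAt.comp p hF

theorem pd_toC (hF : DifferentiableAt ℝ F p) (i : Fin 3) : pd i (toC F) p = pd i F p :=
  pd_clm_comp Complex.ofRealCLM hF i

theorem pd_pd_toC (hF : ContDiffAt ℝ 2 F p) (i j : Fin 3) :
    pd i (pd j (toC F)) p = pd i (pd j F) p := by
  have hF' : pd j (toC F) =ᶠ[𝓝 p] toC (pd j F) :=
    (hF.eventually (by simp)).mono fun q hq => pd_toC (hq.differentiableAt two_ne_zero) j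
  rw [pd_congr hF', pd_toC (differentiableAt_pd hF j)]

theorem pd_comm_inner (hF : ContDiffAt ℝ 3 F p) (i j k : Fin 3) :
    pd i (pd j (pd k F)) p = pd i (pd k (pd j F)) p :=
  pd_congr ((hF.eventually (by simp)).mono fun q hq =>
    pd_comm (hq.of_le (by norm_num)) j k) i

theorem pw_pwbar_toC (hF : ContDiffAt ℝ 2 F p) : pw (pwbar (toC F)) p = lap F p := by
  have hd (i : Fin 3) : DifferentiableAt ℝ (pd i (toC F)) p :=
    differentiableAt_pd (contDiffAt_toC hF) i
  have hpwbar (i : Fin 3) : pd i (pwbar (toC F)) p =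
      (pd i (pd 0 F) p + Complex.I * pd i (pd 1 F) p) / 2 := by
    unfold pwbar
    rw [pd_div_const ((hd 0).fun_add ((hd 1).const_mul _)), pd_add (hd 0) ((hd 1).const_mul _),
      pd_const_mul (hd 1), pd_pd_toC hF, pd_pd_toC hF]
  rw [pw, hpwbar, hpwbar, pd_comm hF 1 0, lap]
  push_cast
  linear_combination -(pd 1 (pd 1 F) p / 4 : ℂ) * Complex.I_sq

theorem S_eq (hF : ContDiffAt ℝ 2 F p) :
    S α F p = ⟨(Real.cos α * pd 0 F p + pd 1 (pd 2 F) p) / 4,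
      (pd 0 (pd 2 F) p - Real.cos α * pd 1 F p) / 4⟩ := by
  have hd := hF.differentiableAt two_ne_zero
  simp only [S, pw, pd_toC hd, pd_pd_toC hF]
  generalize Real.cos α = c
  apply Complex.ext <;> simp <;> ring

theorem fieldEquation_iff (hF : ContDiffAt ℝ 2 F p) :
    FieldEquation α F p ↔
      V α F p * lap F p - ((S α F p).re ^ 2 + (S α F p).im ^ 2) = conf α p := by
  have hd := hF.differentiableAt two_ne_zero
  have hconj : pwbar (toC F) p * (Real.cos α : ℂ) - Complex.I * pwbar (pd 2 (toC F)) p =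
      2 * (starRingEnd ℂ) (S α F p) := by
    simp only [S_eq hF, pwbar, pd_toC hd, pd_pd_toC hF]
    generalize Real.cos α = c
    apply Complex.ext <;> simp <;> ring
  have hS : pw (toC F) p * (Real.cos α : ℂ) + Complex.I * pw (pd 2 (toC F)) p = 2 * S α F p := by
    rw [S, mul_div_cancel₀ _ two_ne_zero]
  have hV : F p * Real.cos α ^ 2 + pd 2 (pd 2 F) p = 4 * V α F p := by
    rw [V, mul_div_cancel₀ _ four_ne_zero]
  have hnorm : (2 * (starRingEnd ℂ) (S α F p)) * (2 * S α F p) =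
      ((4 * Complex.normSq (S α F p) : ℝ) : ℂ) := by
    push_cast
    rw [Complex.normSq_eq_conj_mul_self]
    ring
  rw [FieldEquation, hconj, hS, hV, pw_pwbar_toC hF, hnorm, ← conf, Complex.normSq_apply]
  norm_cast
  constructor <;> intro h <;> linarith

theorem contDiffAt_V {n : WithTop ℕ∞} (hF : ContDiffAt ℝ (n + 2) F p) (α : ℝ) :
    ContDiffAt ℝ n (V α F) p := by
  have hF' : ContDiffAt ℝ (n + 1 + 1) F p := by rwa [add_assoc, one_add_one_eq_two]
  exact (((hF.of_le le_self_add).mul contDiffAt_const).add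
    (contDiffAt_pd (contDiffAt_pd hF' 2) 2)).div_const 4

theorem contDiffAt_pw {n : WithTop ℕ∞} {f : Pt → ℂ} (hf : ContDiffAt ℝ (n + 1) f p) :
    ContDiffAt ℝ n (pw f) p :=
  ((contDiffAt_pd hf 0).sub (contDiffAt_const.mul (contDiffAt_pd hf 1))).div_const 2

theorem contDiffAt_S {n : WithTop ℕ∞} (hF : ContDiffAt ℝ (n + 2) F p) (α : ℝ) :
    ContDiffAt ℝ n (S α F) p := by
  have hF' : ContDiffAt ℝ (n + 1 + 1) (toC F) p :=
    contDiffAt_toC (by rwa [add_assoc, one_add_one_eq_two])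
  exact (((contDiffAt_pw (hF'.of_le le_self_add)).mul contDiffAt_const).add
    (contDiffAt_const.mul (contDiffAt_pw (contDiffAt_pd hF' 2)))).div_const 2

theorem contDiffAt_S_re {n : WithTop ℕ∞} (hF : ContDiffAt ℝ (n + 2) F p) (α : ℝ) :
    ContDiffAt ℝ n (fun q => (S α F q).re) p :=
  Complex.reCLM.contDiff.contDiffAt.comp p (contDiffAt_S hF α)

theorem contDiffAt_S_im {n : WithTop ℕ∞} (hF : ContDiffAt ℝ (n + 2) F p) (α : ℝ) :
    ContDiffAt ℝ n (fun q => (S α F q).im) p :=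
  Complex.imCLM.contDiff.contDiffAt.comp p (contDiffAt_S hF α)

theorem contDiffAt_lap {n : WithTop ℕ∞} (hF : ContDiffAt ℝ (n + 2) F p) :
    ContDiffAt ℝ n (lap F) p := by
  have hF' : ContDiffAt ℝ (n + 1 + 1) F p := by rwa [add_assoc, one_add_one_eq_two]
  exact ((contDiffAt_pd (contDiffAt_pd hF' 0) 0).add
    (contDiffAt_pd (contDiffAt_pd hF' 1) 1)).div_const 4

theorem contDiff_conf (α : ℝ) {n : WithTop ℕ∞} : ContDiff ℝ n (conf α) := by
  unfold conf
  fun_prop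

theorem conf_pos (α : ℝ) (p : Pt) : 0 < conf α p := Real.exp_pos _

theorem d0_conf (α : ℝ) (p : Pt) : d0 (conf α) p = ![0, 0, -2 * Real.sin α * conf α p] := by
  have hconf : conf α = fun q : Pt => Real.exp (-2 * Real.sin α * q 2) := by
    ext q
    rw [conf, mul_right_comm]
  have hderiv := ((hasFDerivAt_apply (𝕜 := ℝ) (2 : Fin 3) p).const_mul (-2 * Real.sin α)).exp
  ext i
  rw [d0, pd, hconf, hderiv.fderiv]
  fin_cases i <;> simp
  ring

theorem e3_eq (α : ℝ) (F : Pt → ℝ) (p : Pt) :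
    e3 α F p = ![(S α F p).im, (S α F p).re, V α F p] := by
  ext i
  fin_cases i <;> simp [e3, dw, dwbar, dv] <;> ring

theorem contDiffAt_e3 {n : WithTop ℕ∞} (hF : ContDiffAt ℝ (n + 2) F p) (α : ℝ) :
    ContDiffAt ℝ n (e3 α F) p := by
  rw [funext (e3_eq α F)]
  exact contDiffAt_vec3 (contDiffAt_S_im hF α) (contDiffAt_S_re hF α) (contDiffAt_V hF α)

theorem contDiffAt_reSdw {n : WithTop ℕ∞} (hF : ContDiffAt ℝ (n + 2) F p) (α : ℝ) :
    ContDiffAt ℝ n (reSdw α F) p :=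
  contDiffAt_vec3 (contDiffAt_S_re hF α) (contDiffAt_S_im hF α).neg contDiffAt_const

theorem nu_eq (hV : V α F p ≠ 0) :
    nu α F p = (2 * Real.cos α / V α F p) • reSdw α F p
      - (4 * Real.sin α / V α F p) • e3 α F p := by
  rw [e3_eq]
  ext i
  unfold nu reSdw
  generalize Real.cos α = c
  generalize Real.sin α = s
  fin_cases i <;> simp [dw, dwbar, dv] <;> field_simp <;> ring

theorem pd_V (hF : ContDiffAt ℝ 3 F p) (α : ℝ) (i : Fin 3) :
    pd i (V α F) p = (Real.cos α ^ 2 * pd i F p + pd i (pd 2 (pd 2 F)) p) / 4 := by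
  have hF1 := hF.differentiableAt three_ne_zero
  unfold V
  simp only [mul_comm _ (Real.cos α ^ 2)]
  rw [pd_div_const ((hF1.const_mul _).fun_add (differentiableAt_pd_pd hF 2 2)),
    pd_add (hF1.const_mul _) (differentiableAt_pd_pd hF 2 2), pd_const_mul hF1]

theorem pd_lap (hF : ContDiffAt ℝ 3 F p) (i : Fin 3) :
    pd i (lap F) p = (pd i (pd 0 (pd 0 F)) p + pd i (pd 1 (pd 1 F)) p) / 4 := by
  unfold lap
  have hd (j k : Fin 3) := differentiableAt_pd_pd hF j k
  rw [pd_div_const ((hd 0 0).fun_add (hd 1 1)), pd_add (hd 0 0) (hd 1 1)]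

theorem S_eventuallyEq (hF : ContDiffAt ℝ 2 F p) (α : ℝ) :
    S α F =ᶠ[𝓝 p] fun q => ⟨(Real.cos α * pd 0 F q + pd 1 (pd 2 F) q) / 4,
      (pd 0 (pd 2 F) q - Real.cos α * pd 1 F q) / 4⟩ :=
  (hF.eventually (by simp)).mono fun _ hq => S_eq hq

theorem pd_S_re (hF : ContDiffAt ℝ 3 F p) (α : ℝ) (i : Fin 3) :
    pd i (fun q => (S α F q).re) p =
      (Real.cos α * pd i (pd 0 F) p + pd i (pd 1 (pd 2 F)) p) / 4 := by
  have hF2 : ContDiffAt ℝ 2 F p := hF.of_le (by norm_num)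
  have hd := (differentiableAt_pd hF2 0).const_mul (Real.cos α)
  rw [pd_congr ((S_eventuallyEq hF2 α).mono fun q hq => congrArg Complex.re hq),
    pd_div_const (hd.fun_add (differentiableAt_pd_pd hF 1 2)),
    pd_add hd (differentiableAt_pd_pd hF 1 2), pd_const_mul (differentiableAt_pd hF2 0)]

theorem pd_S_im (hF : ContDiffAt ℝ 3 F p) (α : ℝ) (i : Fin 3) :
    pd i (fun q => (S α F q).im) p =
      (pd i (pd 0 (pd 2 F)) p - Real.cos α * pd i (pd 1 F) p) / 4 := by
  have hF2 : ContDiffAt ℝ 2 F p := hF.of_le (by norm_num)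
  have hd := (differentiableAt_pd hF2 1).const_mul (Real.cos α)
  rw [pd_congr ((S_eventuallyEq hF2 α).mono fun q hq => congrArg Complex.im hq),
    pd_div_const ((differentiableAt_pd_pd hF 0 2).fun_sub hd),
    pd_sub (differentiableAt_pd_pd hF 0 2) hd, pd_const_mul (differentiableAt_pd hF2 1)]

theorem d0_V (hF : ContDiffAt ℝ 3 F p) (α : ℝ) :
    d0 (V α F) p = (fun i => pd 2 (fun q => e3 α F q i) p) + Real.cos α • reSdw α F p := by
  have hF2 : ContDiffAt ℝ 2 F p := hF.of_le (by norm_num)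
  have hcomm (i : Fin 3) := pd_comm (contDiffAt_pd (n := 2) hF 2) i 2
  ext i
  fin_cases i <;> simp [d0, e3_eq, reSdw, pd_V hF, pd_S_re hF, pd_S_im hF, S_eq hF2]
  · linear_combination hcomm 0 / 4 + Real.cos α / 4 * pd_comm hF2 2 1
  · linear_combination hcomm 1 / 4 - Real.cos α / 4 * pd_comm hF2 2 0

theorem dualVec_d1_e3 (hF : ContDiffAt ℝ 3 F p) (α : ℝ) :
    dualVec (d1 (e3 α F) p) =
      Real.cos α • ![-(S α F p).im, -(S α F p).re, lap F p] := by
  have hF2 : ContDiffAt ℝ 2 F p := hF.of_le (by norm_num)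
  have hcomm := pd_comm (contDiffAt_pd (n := 2) hF 2)
  ext i
  fin_cases i <;>
    simp [d1, dualVec, e3_eq, pd_V hF, pd_S_re hF, pd_S_im hF, S_eq hF2, lap]
  · linear_combination hcomm 1 2 / 4 - Real.cos α / 4 * pd_comm hF2 2 0
  · linear_combination -hcomm 0 2 / 4 - Real.cos α / 4 * pd_comm hF2 2 1
  · linear_combination hcomm 0 1 / 4

theorem dualVec_d1_reSdw (hF : ContDiffAt ℝ 3 F p) (α : ℝ) :
    dualVec (d1 (reSdw α F) p) =
      ![pd 2 (fun q => (S α F q).im) p, pd 2 (fun q => (S α F q).re) p, -pd 2 (lap F) p] := by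
  have hF2 : ContDiffAt ℝ 2 F p := hF.of_le (by norm_num)
  have hcomm (i : Fin 3) := pd_comm (contDiffAt_pd (n := 2) hF i) i 2
  ext i
  fin_cases i <;> simp [d1, dualVec, reSdw, pd_neg, pd_const]
  simp only [pd_lap hF, pd_S_re hF, pd_S_im hF]
  linear_combination -(pd_comm_inner hF 0 0 2 + hcomm 0 + pd_comm_inner hF 1 1 2 + hcomm 1) / 4
    + Real.cos α / 4 * pd_comm hF2 0 1

theorem pd_two_fieldEquation (hF : ContDiffAt ℝ 3 F p) (h : ∀ᶠ q in 𝓝 p, FieldEquation α F q) :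
    pd 2 (V α F) p * lap F p + V α F p * pd 2 (lap F) p
      - 2 * ((S α F p).re * pd 2 (fun q => (S α F q).re) p
        + (S α F p).im * pd 2 (fun q => (S α F q).im) p) = -2 * Real.sin α * conf α p := by
  have hF2 : ∀ᶠ q in 𝓝 p, ContDiffAt ℝ 2 F q :=
    (hF.of_le (by norm_num : (2 : WithTop ℕ∞) ≤ 3)).eventually (by simp)
  have heq : (fun q => V α F q * lap F q - ((S α F q).re ^ 2 + (S α F q).im ^ 2)) =ᶠ[𝓝 p]
      conf α := by
    filter_upwards [h, hF2] with q hq hFq using (fieldEquation_iff hFq).1 hq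
  have hV := (contDiffAt_V (n := 1) hF α).differentiableAt one_ne_zero
  have hlap := (contDiffAt_lap (n := 1) hF).differentiableAt one_ne_zero
  have hre := (contDiffAt_S_re (n := 1) hF α).differentiableAt one_ne_zero
  have him := (contDiffAt_S_im (n := 1) hF α).differentiableAt one_ne_zero
  have hpd := (pd_congr heq 2).trans (congrFun (d0_conf α p) 2)
  simp only [sq] at hpd
  rw [pd_sub (hV.fun_mul hlap) ((hre.fun_mul hre).fun_add (him.fun_mul him)),
    pd_add (hre.fun_mul hre) (him.fun_mul him), pd_mul hV hlap, pd_mul hre hre,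
    pd_mul him him] at hpd
  simp only [cons_val] at hpd
  linear_combination hpd

theorem V_ne_zero (hF : ContDiffAt ℝ 2 F p) (h : FieldEquation α F p) : V α F p ≠ 0 := by
  intro hV
  have hp := (fieldEquation_iff hF).1 h
  rw [hV] at hp
  nlinarith [conf_pos α p, sq_nonneg (S α F p).re, sq_nonneg (S α F p).im]

end FieldData

section Coframe

variable {α : ℝ} {F : Pt → ℝ} {p : Pt}

theorem exp_neg_mul_star_m (α v : ℝ) : Complex.exp (-Complex.I * star (m α) * v) =
    (starRingEnd ℂ) (Complex.exp (Complex.I * m α * v)) := by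
  simp [← Complex.exp_conj]

theorem e1_eq (α : ℝ) (p : Pt) :
    e1 α p = fun j => (Complex.exp (Complex.I * m α * p 2) * dw j).re := by
  ext j
  rw [e1, exp_neg_mul_star_m]
  generalize Complex.exp (Complex.I * m α * p 2) = z
  fin_cases j <;> simp [dw, dwbar] <;> ring

theorem e2_eq (α : ℝ) (p : Pt) :
    e2 α p = fun j => (Complex.exp (Complex.I * m α * p 2) * dw j).im := by
  ext j
  rw [e2, exp_neg_mul_star_m]
  generalize Complex.exp (Complex.I * m α * p 2) = z
  fin_cases j <;> simp [dw, dwbar] <;> ring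

theorem normSq_exp_I_mul_m (α : ℝ) (p : Pt) :
    Complex.normSq (Complex.exp (Complex.I * m α * p 2)) = conf α p := by
  have hre : (Complex.I * m α * p 2).re = -(p 2 * Real.sin α) := by
    simp [m, mul_comm Complex.I, Complex.exp_im]
    ring
  rw [Complex.normSq_eq_norm_sq, Complex.norm_exp, hre, conf, ← Real.exp_nat_mul]
  congr 1
  push_cast
  ring

theorem metric_coframe (α : ℝ) (F : Pt → ℝ) (p : Pt) :
    metric (coframe α F) p =
      conf α p • diagonal ![1, 1, 0] + vecMulVec (e3 α F p) (e3 α F p) := by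
  rw [← normSq_exp_I_mul_m, Complex.normSq_apply]
  ext i j
  simp only [metric, coframe, e1_eq, e2_eq]
  generalize Complex.exp (Complex.I * m α * p 2) = z
  fin_cases i <;> fin_cases j <;>
    simp [dw, vecMulVec_apply, Fin.sum_univ_three] <;> ring

theorem det_coframe (α : ℝ) (F : Pt → ℝ) (p : Pt) :
    (coframe α F p).det = conf α p * V α F p := by
  rw [← normSq_exp_I_mul_m, Complex.normSq_apply]
  simp only [coframe, e1_eq, e2_eq, e3_eq, det_fin_three]
  simp [dw]
  ring

theorem det_coframe_ne_zero (hV : V α F p ≠ 0) : (coframe α F p).det ≠ 0 := by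
  rw [det_coframe]
  exact mul_ne_zero (conf_pos α p).ne' hV

theorem metric_coframe_mulVec (α : ℝ) (F : Pt → ℝ) (p : Pt) (X : Fin 3 → ℝ) :
    metric (coframe α F) p *ᵥ X =
      conf α p • ![X 0, X 1, 0] + (e3 α F p ⬝ᵥ X) • e3 α F p := by
  have hdiag : diagonal ![(1 : ℝ), 1, 0] *ᵥ X = ![X 0, X 1, 0] := by
    ext i
    fin_cases i <;> simp [mulVec_diagonal]
  rw [metric_coframe, add_mulVec, smul_mulVec, vecMulVec_mulVec, hdiag]
  simp

theorem sharp_e3 (hV : V α F p ≠ 0) :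
    sharp (coframe α F) (e3 α F) p = ![0, 0, 1 / V α F p] := by
  apply sharp_eq_of_metric_mulVec_eq (det_coframe_ne_zero hV)
  rw [metric_coframe_mulVec, e3_eq]
  simp [dotProduct, Fin.sum_univ_three, hV]

end Coframe

section EinsteinWeyl

variable {α : ℝ} {F : Pt → ℝ} {p : Pt}

theorem V_eventually_ne_zero (hF : ContDiffAt ℝ 2 F p) (h : ∀ᶠ q in 𝓝 p, FieldEquation α F q) :
    ∀ᶠ q in 𝓝 p, V α F q ≠ 0 := by
  filter_upwards [h, hF.eventually (by simp)] with q hq hFq using V_ne_zero hFq hq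

theorem twist_coframe_e3 (hF : ContDiffAt ℝ 3 F p) (h : FieldEquation α F p) :
    twist (coframe α F) (e3 α F) p = Real.cos α / V α F p := by
  have hF2 : ContDiffAt ℝ 2 F p := hF.of_le (by norm_num)
  have hV := V_ne_zero hF2 h
  have hconf := (conf_pos α p).ne'
  have hdot : e3 α F p ⬝ᵥ dualVec (d1 (e3 α F) p) = Real.cos α * conf α p := by
    rw [dualVec_d1_e3 hF, e3_eq, ← (fieldEquation_iff hF2).1 h]
    simp [dotProduct, Fin.sum_univ_three]
    ring
  rw [twist_eq, hdot, det_coframe]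
  field_simp

theorem divergence_coframe_e3 (hF : ContDiffAt ℝ 2 F p)
    (h : ∀ᶠ q in 𝓝 p, FieldEquation α F q) :
    divergence (coframe α F) (e3 α F) p = -2 * Real.sin α / V α F p := by
  have hV := V_ne_zero hF h.self_of_nhds
  have hconf := (conf_pos α p).ne'
  have hdensity (i : Fin 3) :
      (fun q => (coframe α F q).det * sharp (coframe α F) (e3 α F) q i) =ᶠ[𝓝 p]
        fun q => ![0, 0, conf α q] i := by
    filter_upwards [V_eventually_ne_zero hF h] with q hq
    rw [sharp_e3 hq, det_coframe]
    fin_cases i <;> simp [hq]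
  have hpd : pd 2 (conf α) p = -2 * Real.sin α * conf α p := congrFun (d0_conf α p) 2
  rw [divergence_eq, Fin.sum_univ_three, pd_congr (hdensity 0), pd_congr (hdensity 1),
    pd_congr (hdensity 2), det_coframe]
  simp only [cons_val, pd_const, hpd]
  field_simp
  ring

theorem sharp_e3_eventuallyEq (hF : ContDiffAt ℝ 2 F p)
    (h : ∀ᶠ q in 𝓝 p, FieldEquation α F q) :
    sharp (coframe α F) (e3 α F) =ᶠ[𝓝 p] fun q => ![0, 0, 1 / V α F q] :=
  (V_eventually_ne_zero hF h).mono fun _ hq => sharp_e3 hq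

theorem contDiffAt_sharp_e3 {n : WithTop ℕ∞} (hF : ContDiffAt ℝ (n + 2) F p)
    (h : ∀ᶠ q in 𝓝 p, FieldEquation α F q) :
    ContDiffAt ℝ n (sharp (coframe α F) (e3 α F)) p := by
  have hF2 : ContDiffAt ℝ 2 F p := hF.of_le le_add_self
  have hV : ContDiffAt ℝ n (fun q => 1 / V α F q) p :=
    contDiffAt_const.div (contDiffAt_V hF α) (V_ne_zero hF2 h.self_of_nhds)
  exact (contDiffAt_vec3 contDiffAt_const contDiffAt_const hV).congr_of_eventuallyEq
    (sharp_e3_eventuallyEq hF2 h)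

theorem differentiableAt_metric_coframe (hF : ContDiffAt ℝ 3 F p) (α : ℝ) (i j : Fin 3) :
    DifferentiableAt ℝ (fun q => metric (coframe α F) q i j) p := by
  have he3 (k : Fin 3) : DifferentiableAt ℝ (fun q => e3 α F q k) p :=
    differentiableAt_pi.1 ((contDiffAt_e3 (n := 1) hF α).differentiableAt one_ne_zero) k
  have hconf := ((contDiff_conf α).differentiable one_ne_zero).differentiableAt (x := p)
  simp only [metric_coframe, Matrix.add_apply, Matrix.smul_apply, vecMulVec_apply, smul_eq_mul]
  exact (hconf.mul_const _).fun_add ((he3 i).fun_mul (he3 j))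

theorem dualVec_d1_e3_cross_sharp (hF : ContDiffAt ℝ 3 F p) (hV : V α F p ≠ 0) :
    dualVec (d1 (e3 α F) p) ⨯₃ sharp (coframe α F) (e3 α F) p =
      -(Real.cos α / V α F p) • reSdw α F p := by
  rw [dualVec_d1_e3 hF, sharp_e3 hV, reSdw]
  ext i
  fin_cases i <;> simp [cross_apply] <;> ring

theorem nu_dotProduct_sharp_e3 (hV : V α F p ≠ 0) :
    nu α F p ⬝ᵥ sharp (coframe α F) (e3 α F) p = -(4 * Real.sin α / V α F p) := by
  rw [nu_eq hV, sharp_e3 hV, reSdw, e3_eq]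
  simp [dotProduct, Fin.sum_univ_three, hV, div_eq_mul_inv]

theorem weylDAlong_sharp_e3 (hF : ContDiffAt ℝ 3 F p) (h : ∀ᶠ q in 𝓝 p, FieldEquation α F q) :
    weylDAlong (coframe α F) (nu α F) (sharp (coframe α F) (e3 α F)) p
        (sharp (coframe α F) (e3 α F) p) =
      (2 * Real.sin α / V α F p) • sharp (coframe α F) (e3 α F) p := by
  have hF2 : ContDiffAt ℝ 2 F p := hF.of_le (by norm_num)
  have hV := V_ne_zero hF2 h.self_of_nhds
  have hlower : e3 α F =ᶠ[𝓝 p]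
      fun q => metric (coframe α F) q *ᵥ sharp (coframe α F) (e3 α F) q :=
    (V_eventually_ne_zero hF2 h).mono fun q hq =>
      (metric_mulVec_invMetric (det_coframe_ne_zero hq) _).symm
  have hunit : ∀ᶠ q in 𝓝 p, e3 α F q ⬝ᵥ sharp (coframe α F) (e3 α F) q = 1 := by
    filter_upwards [V_eventually_ne_zero hF2 h] with q hq
    simp [sharp_e3 hq, e3_eq, dotProduct, Fin.sum_univ_three, hq]
  apply metric_mulVec_injective (det_coframe_ne_zero hV)
  rw [metric_mulVec_weylDAlong_self (det_coframe_ne_zero hV)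
      (differentiableAt_metric_coframe hF α)
      ((contDiffAt_sharp_e3 (n := 1) hF h).differentiableAt one_ne_zero) hlower hunit,
    dualVec_d1_e3_cross_sharp hF hV, nu_dotProduct_sharp_e3 hV, nu_eq hV, mulVec_smul,
    show metric (coframe α F) p *ᵥ sharp (coframe α F) (e3 α F) p = e3 α F p from
      hlower.self_of_nhds.symm]
  module

theorem inner_sharp_e3 (hV : V α F p ≠ 0) (X : Fin 3 → ℝ) :
    inner (coframe α F) p X (sharp (coframe α F) (e3 α F) p) = e3 α F p ⬝ᵥ X := by
  rw [inner_eq_dotProduct, dotProduct_comm]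
  exact congrArg (· ⬝ᵥ X) (metric_mulVec_invMetric (det_coframe_ne_zero hV) _)

theorem inner_weylDAlong_sharp_e3_add_swap (hF : ContDiffAt ℝ 3 F p)
    (h : ∀ᶠ q in 𝓝 p, FieldEquation α F q) {X Y : Fin 3 → ℝ}
    (hX : e3 α F p ⬝ᵥ X = 0) (hY : e3 α F p ⬝ᵥ Y = 0) :
    inner (coframe α F) p
          (weylDAlong (coframe α F) (nu α F) (sharp (coframe α F) (e3 α F)) p X) Y
        + inner (coframe α F) p
          (weylDAlong (coframe α F) (nu α F) (sharp (coframe α F) (e3 α F)) p Y) X =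
      (2 * Real.sin α / V α F p) * inner (coframe α F) p X Y := by
  have hF2 : ContDiffAt ℝ 2 F p := hF.of_le (by norm_num)
  have hV := V_ne_zero hF2 h.self_of_nhds
  have hconf := (conf_pos α p).ne'
  have hflat : ∀ᶠ q in 𝓝 p,
      diagonal ![(1 : ℝ), 1, 0] *ᵥ sharp (coframe α F) (e3 α F) q = 0 := by
    filter_upwards [V_eventually_ne_zero hF2 h] with q hq
    rw [sharp_e3 hq]
    ext i
    fin_cases i <;> simp [mulVec_diagonal]
  rw [inner_weylDAlong_add_swap_of_transverse (det_coframe_ne_zero hV)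
    (.of_eq (funext (metric_coframe α F))) hflat
    ((contDiff_conf α).differentiable one_ne_zero).differentiableAt hconf
    ((contDiffAt_e3 (n := 1) hF α).differentiableAt one_ne_zero)
    ((contDiffAt_sharp_e3 (n := 1) hF h).differentiableAt one_ne_zero) _ hX hY,
    nu_dotProduct_sharp_e3 hV, d0_conf, sharp_e3 hV]
  congr 1
  simp [dotProduct, Fin.sum_univ_three]
  field_simp
  ring

theorem isShearFreeGeodesicCongruence_sharp_e3 {U : Set Pt}
    (hF : ∀ p ∈ U, ContDiffAt ℝ ∞ F p) (h : ∀ p ∈ U, ∀ᶠ q in 𝓝 p, FieldEquation α F q) :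
    IsShearFreeGeodesicCongruence U (coframe α F) (nu α F)
      (sharp (coframe α F) (e3 α F)) where
  smooth p hp := (contDiffAt_sharp_e3 (n := ∞) (hF p hp) (h p hp)).contDiffWithinAt
  ne_zero p hp := by
    have hV := V_ne_zero ((hF p hp).of_le (by norm_cast)) (h p hp).self_of_nhds
    rw [sharp_e3 hV]
    exact fun h0 => one_div_ne_zero hV (congrFun h0 2)
  geodesic p hp := ⟨_, weylDAlong_sharp_e3 ((hF p hp).of_le (by norm_cast)) (h p hp)⟩
  shear_free p hp := by
    have hV := V_ne_zero ((hF p hp).of_le (by norm_cast)) (h p hp).self_of_nhds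
    refine ⟨2 * Real.sin α / V α F p, fun X Y hX hY => ?_⟩
    rw [inner_sharp_e3 hV] at hX hY
    exact inner_weylDAlong_sharp_e3_add_swap ((hF p hp).of_le (by norm_cast)) (h p hp) hX hY

theorem d0_add_half_nu_mul {T : Pt → ℝ} {k : ℝ} (hF : ContDiffAt ℝ 3 F p) (hV : V α F p ≠ 0)
    (hT : T =ᶠ[𝓝 p] fun q => k / V α F q) :
    (fun i => d0 T p i + (1 / 2) * nu α F p i * T p) =
      (-k / V α F p ^ 2) • ((fun i => pd 2 (fun q => e3 α F q i) p)
        + (2 * Real.sin α) • e3 α F p) := by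
  have hdT : d0 T p = -(k / V α F p ^ 2) • d0 (V α F) p := by
    ext i
    exact (pd_congr hT i).trans
      (pd_const_div ((contDiffAt_V (n := 1) hF α).differentiableAt one_ne_zero) hV k i)
  ext i
  rw [hdT, d0_V hF, nu_eq hV, hT.self_of_nhds]
  simp only [Pi.add_apply, Pi.sub_apply, Pi.smul_apply, smul_eq_mul]
  field_simp
  ring

theorem dualVec_d1_const_div_mul_reSdw (hF : ContDiffAt ℝ 3 F p) (hV : V α F p ≠ 0) (k : ℝ) :
    dualVec (d1 (fun q i => k / V α F q * reSdw α F q i) p) =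
      (k / V α F p ^ 2) • (V α F p • dualVec (d1 (reSdw α F) p)
        - (fun i => pd 2 (fun q => e3 α F q i) p) ⨯₃ reSdw α F p) := by
  have hdV := (contDiffAt_V (n := 1) hF α).differentiableAt one_ne_zero
  have hdf : DifferentiableAt ℝ (fun q => k / V α F q) p := by
    simpa only [div_eq_mul_inv] using (hdV.fun_inv hV).const_mul k
  have hdσ := (contDiffAt_reSdw (n := 1) hF α).differentiableAt one_ne_zero
  have hd0f : d0 (fun q => k / V α F q) p = -(k / V α F p ^ 2) • d0 (V α F) p :=
    funext fun i => pd_const_div hdV hV k i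
  have hcross : d0 (V α F) p ⨯₃ reSdw α F p =
      (fun i => pd 2 (fun q => e3 α F q i) p) ⨯₃ reSdw α F p := by
    simp [d0_V hF]
  have hscale : k / V α F p = k / V α F p ^ 2 * V α F p := by field_simp
  rw [dualVec_d1_mul hdf hdσ, hd0f, map_smul,
    LinearMap.smul_apply, hcross, smul_sub, smul_smul, ← hscale, neg_smul, sub_eq_add_neg]

theorem metric_mulVec_dualVec_d1_const_div_mul_reSdw (hF : ContDiffAt ℝ 3 F p)
    (h : ∀ᶠ q in 𝓝 p, FieldEquation α F q) (k : ℝ) :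
    metric (coframe α F) p *ᵥ dualVec (d1 (fun q i => k / V α F q * reSdw α F q i) p) =
      (coframe α F p).det • (k / V α F p ^ 2) • ((fun i => pd 2 (fun q => e3 α F q i) p)
        + (2 * Real.sin α) • e3 α F p) := by
  have hF2 : ContDiffAt ℝ 2 F p := hF.of_le (by norm_num)
  have hfield := (fieldEquation_iff hF2).1 h.self_of_nhds
  have hfield_v := pd_two_fieldEquation hF h
  have hde3 : (fun i => pd 2 (fun q => e3 α F q i) p) =
      ![pd 2 (fun q => (S α F q).im) p, pd 2 (fun q => (S α F q).re) p, pd 2 (V α F) p] := by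
    ext i
    fin_cases i <;> simp [e3_eq]
  rw [dualVec_d1_const_div_mul_reSdw hF (V_ne_zero hF2 h.self_of_nhds), dualVec_d1_reSdw hF,
    mulVec_smul, smul_comm (coframe α F p).det, hde3, reSdw, metric_coframe_mulVec, det_coframe]
  congr 1
  set c := V α F p • ![pd 2 (fun q => (S α F q).im) p, pd 2 (fun q => (S α F q).re) p,
      -pd 2 (lap F) p]
    - ![pd 2 (fun q => (S α F q).im) p, pd 2 (fun q => (S α F q).re) p, pd 2 (V α F) p] ⨯₃
      ![(S α F p).re, -(S α F p).im, 0] with hc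
  have hdot : e3 α F p ⬝ᵥ c =
      conf α p * (2 * Real.sin α * V α F p + pd 2 (V α F) p) := by
    simp [hc, e3_eq, cross_apply, dotProduct, Fin.sum_univ_three]
    linear_combination pd 2 (V α F) p * hfield - V α F p * hfield_v
  rw [hdot, e3_eq]
  ext i
  fin_cases i <;> simp [hc, cross_apply] <;> ring

theorem solvesMonopole_of_eq_div {U : Set Pt} {T : Pt → ℝ} {k : ℝ} (hU : IsOpen U)
    (hF : ∀ p ∈ U, ContDiffAt ℝ ∞ F p) (h : ∀ p ∈ U, FieldEquation α F p)
    (hT : ∀ p ∈ U, T p = k / V α F p) :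
    SolvesMonopole U (coframe α F) (nu α F) T := by
  have hV (p : Pt) (hp : p ∈ U) : V α F p ≠ 0 :=
    V_ne_zero ((hF p hp).of_le (by norm_cast)) (h p hp)
  have hdiv (c : ℝ) (p : Pt) (hp : p ∈ U) : ContDiffAt ℝ ∞ (fun q => c / V α F q) p :=
    contDiffAt_const.div (contDiffAt_V (n := ∞) (hF p hp) α) (hV p hp)
  refine ⟨fun p hp => ?_, fun q i => -k / V α F q * reSdw α F q i, fun p hp => ?_, fun p hp => ?_⟩
  · exact ((hdiv k p hp).contDiffWithinAt (s := U)).congr hT (hT p hp)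
  · exact ((hdiv (-k) p hp).smul
      (contDiffAt_reSdw (n := ∞) (hF p hp) α)).contDiffWithinAt
  · have hF3 : ContDiffAt ℝ 3 F p := (hF p hp).of_le (by norm_cast)
    have hnear := hU.mem_nhds hp
    refine star1_eq_of_metric_mulVec_dualVec (det_coframe_ne_zero (hV p hp)) (d1_skew _ p) ?_
    rw [metric_mulVec_dualVec_d1_const_div_mul_reSdw hF3 (Filter.eventually_of_mem hnear h),
      d0_add_half_nu_mul hF3 (hV p hp) (Filter.eventually_of_mem hnear hT)]

end EinsteinWeyl

end EW

theorem mainTheorem8 (α : ℝ) (U : Set EW.Pt) (hU : IsOpen U) (F : EW.Pt → ℝ)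
    (hF : ContDiffOn ℝ ∞ F U) (hEq : ∀ p ∈ U, EW.FieldEquation α F p) :
    EW.IsShearFreeGeodesicCongruence U (EW.coframe α F) (EW.nu α F)
        (EW.sharp (EW.coframe α F) (EW.e3 α F)) ∧
      (∀ p ∈ U, EW.V α F p ≠ 0 ∧
        EW.twist (EW.coframe α F) (EW.e3 α F) p = Real.cos α / EW.V α F p ∧
        EW.divergence (EW.coframe α F) (EW.e3 α F) p = -2 * Real.sin α / EW.V α F p) ∧
      (Real.sin α ≠ 0 → ∃ c : ℝ, ∀ p ∈ U,
        EW.twist (EW.coframe α F) (EW.e3 α F) p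
          = c * EW.divergence (EW.coframe α F) (EW.e3 α F) p) ∧
      (Real.cos α ≠ 0 → ∃ c : ℝ, ∀ p ∈ U,
        EW.divergence (EW.coframe α F) (EW.e3 α F) p
          = c * EW.twist (EW.coframe α F) (EW.e3 α F) p) ∧
      EW.SolvesMonopole U (EW.coframe α F) (EW.nu α F)
        (EW.twist (EW.coframe α F) (EW.e3 α F)) ∧
      EW.SolvesMonopole U (EW.coframe α F) (EW.nu α F)
        (EW.divergence (EW.coframe α F) (EW.e3 α F)) := by
  have hF' (p) (hp : p ∈ U) : ContDiffAt ℝ ∞ F p := hF.contDiffAt (hU.mem_nhds hp)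
  have hEq' (p) (hp : p ∈ U) : ∀ᶠ q in nhds p, EW.FieldEquation α F q :=
    Filter.eventually_of_mem (hU.mem_nhds hp) hEq
  have hV (p) (hp : p ∈ U) := EW.V_ne_zero ((hF' p hp).of_le (by norm_cast)) (hEq p hp)
  have ht (p) (hp : p ∈ U) := EW.twist_coframe_e3 ((hF' p hp).of_le (by norm_cast)) (hEq p hp)
  have hd (p) (hp : p ∈ U) :=
    EW.divergence_coframe_e3 ((hF' p hp).of_le (by norm_cast)) (hEq' p hp)
  refine ⟨EW.isShearFreeGeodesicCongruence_sharp_e3 hF' hEq',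
    fun p hp => ⟨hV p hp, ht p hp, hd p hp⟩,
    fun hs => ⟨-Real.cos α / (2 * Real.sin α), fun p hp => ?_⟩,
    fun hc => ⟨-(2 * Real.sin α) / Real.cos α, fun p hp => ?_⟩,
    EW.solvesMonopole_of_eq_div hU hF' hEq ht, EW.solvesMonopole_of_eq_div hU hF' hEq hd⟩
  · have := hV p hp
    rw [ht p hp, hd p hp]
    field_simp
  · have := hV p hp
    rw [ht p hp, hd p hp]
    field_simp
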